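/- Let $2^\omega$ be the set of infinite sequences of $0$'s and $1$'s with coordinatewise addition modulo $2$, and let $\mu$ be the Lebesgue measure on $2^\omega$ (the product of the uniform measures on $\{0,1\}$). A set $X\subseteq 2^\omega$ is *null-additive* if for every $A\subseteq 2^\omega$ with $\mu(A)=0$ also $\mu(X+A)=0$, where $X+A=\{x+a : x\in X,\ a\in A\}$. A *tree* is a nonempty set $T$ of finite sequences of $0$'s and $1$'s that is closed under initial segments and such that every $\eta\in T$ has, for every $n>\operatorname{length}(\eta)$, an extension of length $n$ in $T$. Put $\operatorname{Lim}(T)=\{x\in 2^\omega : x\restriction n\in T \text{ for every } n<\omega\}$. For $A\subseteq 2^\omega$ let $A^{\mathrm{fin}}$ be the set of all $y\in 2^\omega$ for which there is an $x\in A$ with $y(n)=x(n)$ for all but finitely many $n$. A *corset* is a nondecreasing function $f:\omega\to\omega\setminus\{0\}$ that converges to infinity. A tree $T$ is *of width* $f$ if $|T\cap 2^n|\le f(n)$ for every $n<\omega$, and *almost of width* $f$ if $|T\cap 2^n|\le f(n)$ for all sufficiently large $n$, where $2^n$ denotes the set of $0$-$1$ sequences of length $n$. **Theorem.** For every $X\subseteq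 2^\omega$ the following conditions are equivalent: (a) $X$ is null-additive. (b) For every corset $f$ there is a tree $S$ of width $f$ such that $X\subseteq \operatorname{Lim}(S)^{\mathrm{fin}}$. (c) For every corset $f$ there are trees $S_m$, $m<\omega$, almost of width $f$, such that $X\subseteq\bigcup_{m<\omega}\operatorname{Lim}(S_m)^{\mathrm{fin}}$. (d) For every corset $f$ there are trees $S_m$, $m<\omega$, of width $f$, such that $X\subseteq\bigcup_{m<\omega}\operatorname{Lim}(S_m)$. -/

import Mathlib

open scoped Pointwise

namespace NullAdditive

/-- The Cantor space `2^ω`; its addition is the pointwise addition modulo 2. -/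
abbrev Cantor : Type := ℕ → Fin 2

/-- The Lebesgue measure on `2^ω`: the product of the fair-coin measures on `{0, 1}`. -/
noncomputable def lebesgue : MeasureTheory.Measure Cantor :=
  MeasureTheory.Measure.infinitePi fun _ : ℕ => (PMF.uniformOfFintype (Fin 2)).toMeasure

/-- `X` is null-additive if `X + A` is null for every null set `A` (measurable or not: the measure
of an arbitrary set is its outer measure). -/
def IsNullAdditive (X : Set Cantor) : Prop :=
  ∀ A : Set Cantor, lebesgue A = 0 → lebesgue (X + A) = 0

/-- A tree: a nonempty set of finite 0-1 sequences that is closed under initial segments and in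
which every element has extensions of every larger length. -/
structure IsTree (T : Set (List (Fin 2))) : Prop where
  nonempty : T.Nonempty
  prefix_mem : ∀ η ν : List (Fin 2), η <+: ν → ν ∈ T → η ∈ T
  exists_extension : ∀ η ∈ T, ∀ n : ℕ, η.length < n → ∃ ν ∈ T, ν.length = n ∧ η <+: ν

/-- The initial segment `⟨x 0, …, x (n - 1)⟩` of `x`. -/
def initSeg (x : Cantor) (n : ℕ) : List (Fin 2) :=
  (List.range n).map x

/-- The set of the infinite branches of `T`. -/
def Lim (T : Set (List (Fin 2))) : Set Cantor :=
  {x | ∀ n : ℕ, initSeg x n ∈ T}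

/-- `A^fin`: the points that agree with some point of `A` at all but finitely many places. -/
def finClosure (A : Set Cantor) : Set Cantor :=
  {y | ∃ x ∈ A, ∀ᶠ n in Filter.cofinite, y n = x n}

/-- The elements of `T` of length `n`. -/
def level (T : Set (List (Fin 2))) (n : ℕ) : Set (List (Fin 2)) :=
  {η ∈ T | η.length = n}

/-- A corset: a nondecreasing function from `ω` to `ω ∖ {0}` that converges to infinity. -/
structure IsCorset (f : ℕ → ℕ) : Prop where
  monotone : Monotone f
  pos : ∀ n : ℕ, 0 < f n
  tendsto : Filter.Tendsto f Filter.atTop Filter.atTop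

/-- Every level `n` of `T` has at most `f n` elements. -/
def OfWidth (T : Set (List (Fin 2))) (f : ℕ → ℕ) : Prop :=
  ∀ n : ℕ, (level T n).encard ≤ (f n : ℕ∞)

/-- Every sufficiently high level `n` of `T` has at most `f n` elements. -/
def AlmostOfWidth (T : Set (List (Fin 2))) (f : ℕ → ℕ) : Prop :=
  ∀ᶠ n in Filter.atTop, (level T n).encard ≤ (f n : ℕ∞)

end NullAdditive

namespace NullAdditive

open Set Filter MeasureTheory Topology
open scoped ENNReal

/-! The implications proved are (a) → (c) → (d) → (b) → (c) and (d) → (a).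

(c) → (d) → (b) is surgery on stems: there are only countably many finite stems, and countably many
trees of width `√f` fit into one of width `f` if the later ones leave a common stem late enough.

(d) → (a): a null set lies in the limsup of sets `G n`, determined by `n` coordinates, with `∑ μ(G
n) < ∞`. Some corset `f` keeps `∑ f n * μ(G n)` finite. A tree of width `f` needs at most `f n`
translates of `G n` at level `n`, so Borel–Cantelli applies.

(a) → (c): the null set to test is the limsup of clopen sets `C k` of measure `2⁻ᵏ`, whose
translates by points differing below a level `N` are pairwise independent
(`lebesgue_inter_hashKernel_le`). Since `X + limsup C` is null, a closed set `L` avoids it. By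
Baire's theorem each `x ∈ X` has a basic open `U` meeting `L` such that `x + C k` avoids `U ∩ L` for
all large `k`. By Chebyshev's inequality, few initial segments of such `x` are possible
(`encard_image_initSeg_le`), and there are countably many choices of `U` and of the bound on `k`. -/

/-! ### Trees spanned by sets of points, and change of stems. -/

theorem length_initSeg (x : Cantor) (n : ℕ) : (initSeg x n).length = n := by
  simp [initSeg]

theorem initSeg_eq_initSeg_iff {x y : Cantor} {n : ℕ} :
    initSeg x n = initSeg y n ↔ ∀ i < n, x i = y i := by
  simp [initSeg]

theorem take_initSeg (x : Cantor) {m n : ℕ} (h : m ≤ n) :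
    (initSeg x n).take m = initSeg x m := by
  simp [initSeg, ← List.map_take, List.take_range, h]

theorem initSeg_prefix_initSeg (x : Cantor) {m n : ℕ} (h : m ≤ n) :
    initSeg x m <+: initSeg x n := by
  rw [← take_initSeg x h]
  exact List.take_prefix _ _

theorem image_initSeg_Lim_subset (T : Set (List (Fin 2))) (n : ℕ) :
    (initSeg · n) '' Lim T ⊆ level T n := by
  rintro _ ⟨x, hx, rfl⟩
  exact ⟨hx n, length_initSeg x n⟩

/-- The set of the initial segments of the points of `P`. -/
def treeOf (P : Set Cantor) : Set (List (Fin 2)) :=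
  {η | ∃ x ∈ P, ∃ n, initSeg x n = η}

theorem isTree_treeOf {P : Set Cantor} (hP : P.Nonempty) : IsTree (treeOf P) where
  nonempty := let ⟨x, hx⟩ := hP; ⟨initSeg x 0, x, hx, 0, rfl⟩
  prefix_mem := by
    rintro η _ h ⟨x, hx, n, rfl⟩
    have hl := h.length_le
    rw [length_initSeg] at hl
    refine ⟨x, hx, η.length, ?_⟩
    rw [← take_initSeg x hl]
    exact (List.prefix_iff_eq_take.1 h).symm
  exists_extension := by
    rintro _ ⟨x, hx, n, rfl⟩ m hm
    rw [length_initSeg] at hm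
    exact ⟨initSeg x m, ⟨x, hx, m, rfl⟩, length_initSeg x m, initSeg_prefix_initSeg x hm.le⟩

theorem level_treeOf (P : Set Cantor) (n : ℕ) : level (treeOf P) n = (initSeg · n) '' P := by
  ext η
  constructor
  · rintro ⟨⟨x, hx, m, rfl⟩, hm⟩
    rw [length_initSeg] at hm
    exact ⟨x, hx, by rw [hm]⟩
  · rintro ⟨x, hx, rfl⟩
    exact ⟨⟨x, hx, n, rfl⟩, length_initSeg x n⟩

theorem subset_Lim_treeOf (P : Set Cantor) : P ⊆ Lim (treeOf P) :=
  fun x hx n => ⟨x, hx, n, rfl⟩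

/-- Every set of points is covered by a tree that is no wider than the set requires. -/
theorem exists_isTree_subset_Lim (P : Set Cantor) :
    ∃ T, IsTree T ∧ P ⊆ Lim T ∧
      ∀ n, ∀ c : ℕ, 0 < c → ((initSeg · n) '' P).encard ≤ c → (level T n).encard ≤ c := by
  rcases P.eq_empty_or_nonempty with rfl | hP
  -- A tree is nonempty, so even the empty set costs one branch; hence `0 < c`.
  · refine ⟨treeOf {0}, isTree_treeOf (singleton_nonempty _), empty_subset _, fun n c hc _ => ?_⟩
    rw [level_treeOf, image_singleton, encard_singleton]
    exact_mod_cast hc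
  · exact ⟨treeOf P, isTree_treeOf hP, subset_Lim_treeOf P, fun n c _ h => by rwa [level_treeOf]⟩

/-- The point that starts with `s` and continues like `x`. -/
def splice (s : List (Fin 2)) (x : Cantor) : Cantor :=
  fun n => if n < s.length then s.getD n 0 else x n

theorem initSeg_splice_of_le {s : List (Fin 2)} (x : Cantor) {n : ℕ} (h : n ≤ s.length) :
    initSeg (splice s x) n = s.take n := by
  apply List.ext_getElem
  · simp [initSeg, h]
  · intro i h₁ h₂
    have hi : i < s.length := by simp at h₂; omega
    simp [initSeg, splice, hi]

theorem initSeg_splice {s : List (Fin 2)} {x y : Cantor} {n : ℕ}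
    (h : initSeg x n = initSeg y n) : initSeg (splice s x) n = initSeg (splice s y) n := by
  rw [initSeg_eq_initSeg_iff] at h ⊢
  intro i hi
  simp [splice, h i hi]

theorem splice_initSeg {x y : Cantor} {k : ℕ} (h : ∀ n, k ≤ n → y n = x n) :
    splice (initSeg y k) x = y := by
  ext1 n
  by_cases hn : n < k
  · simp [splice, initSeg, hn]
  · simp [splice, initSeg, hn, h n (not_lt.1 hn)]

theorem encard_image_initSeg_splice_le (s : List (Fin 2)) (P : Set Cantor) (n : ℕ) :
    ((initSeg · n) '' (splice s '' P)).encard ≤ ((initSeg · n) '' P).encard := by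
  classical
  have : ∃ g : List (Fin 2) → List (Fin 2),
      ∀ x ∈ P, g (initSeg x n) = initSeg (splice s x) n := by
    refine ⟨fun η => if h : ∃ x, initSeg x n = η then initSeg (splice s h.choose) n else [],
      fun x _ => ?_⟩
    have h : ∃ y, initSeg y n = initSeg x n := ⟨x, rfl⟩
    simp only [dif_pos h]
    exact initSeg_splice h.choose_spec
  obtain ⟨g, hg⟩ := this
  have : (initSeg · n) '' (splice s '' P) = g '' ((initSeg · n) '' P) := by
    rw [image_image, image_image]
    exact image_congr fun x hx => (hg x hx).symm
  rw [this]
  exact encard_image_le _ _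

theorem eventually_cofinite_eq_iff {x y : Cantor} :
    (∀ᶠ n in cofinite, y n = x n) ↔ ∃ k, ∀ n, k ≤ n → y n = x n := by
  rw [Nat.cofinite_eq_atTop, eventually_atTop]

/-! ### Merging countable families of trees. -/

/-- Countably many trees almost of width `f` can be replaced by countably many trees of width `f`
whose branches also exhaust all finite modifications. -/
theorem exists_ofWidth_of_almostOfWidth {f : ℕ → ℕ} (hf : IsCorset f)
    {S : ℕ → Set (List (Fin 2))} (hS : ∀ m, AlmostOfWidth (S m) f) :
    ∃ T : ℕ → Set (List (Fin 2)), (∀ m, IsTree (T m) ∧ OfWidth (T m) f) ∧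
      ⋃ m, finClosure (Lim (S m)) ⊆ ⋃ m, Lim (T m) := by
  -- A stem that reaches the levels where `S p.1` is narrow leaves one node on each level up to its
  -- own length. Shorter stems get a dummy tree.
  have key : ∀ p : ℕ × List (Fin 2), ∃ T, IsTree T ∧ OfWidth T f ∧
      ((∀ n, p.2.length ≤ n → (level (S p.1) n).encard ≤ f n) →
        splice p.2 '' Lim (S p.1) ⊆ Lim T) := by
    rintro ⟨m, s⟩
    by_cases h : ∀ n, s.length ≤ n → (level (S m) n).encard ≤ f n
    · obtain ⟨T, hT, hPT, hw⟩ := exists_isTree_subset_Lim (splice s '' Lim (S m))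
      refine ⟨T, hT, fun n => hw n _ (hf.pos n) ?_, fun _ => hPT⟩
      rcases le_total s.length n with hn | hn
      · exact (encard_image_initSeg_splice_le s _ n).trans
          ((encard_le_encard (image_initSeg_Lim_subset _ n)).trans (h n hn))
      · have : (initSeg · n) '' (splice s '' Lim (S m)) ⊆ {s.take n} := by
          rintro _ ⟨_, ⟨x, -, rfl⟩, rfl⟩
          exact initSeg_splice_of_le x hn
        refine (encard_le_encard this).trans ?_
        rw [encard_singleton]
        exact_mod_cast hf.pos n
    · obtain ⟨T, hT, -, hw⟩ := exists_isTree_subset_Lim ∅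
      exact ⟨T, hT, fun n => hw n _ (hf.pos n) (by simp), fun h' => absurd h' h⟩
  choose T hT hw hLim using key
  obtain ⟨e, he⟩ := exists_surjective_nat (ℕ × List (Fin 2))
  refine ⟨fun m => T (e m), fun m => ⟨hT _, hw _⟩, ?_⟩
  intro y hy
  obtain ⟨m, x, hx, hyx⟩ := mem_iUnion.1 hy
  obtain ⟨k, hk⟩ := eventually_cofinite_eq_iff.1 hyx
  obtain ⟨j, hj⟩ := eventually_atTop.1 (hS m)
  obtain ⟨i, hi⟩ := he (m, initSeg y (max k j))
  refine mem_iUnion.2 ⟨i, ?_⟩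
  simp only [hi]
  refine hLim _ (fun n hn => hj n ?_) ⟨x, hx, ?_⟩
  · rw [length_initSeg] at hn
    exact (le_max_right _ _).trans hn
  · exact splice_initSeg fun n hn => hk n ((le_max_left _ _).trans hn)

theorem IsCorset.sqrt {f : ℕ → ℕ} (hf : IsCorset f) : IsCorset fun n => (f n).sqrt where
  monotone _ _ h := Nat.sqrt_le_sqrt (hf.monotone h)
  pos n := Nat.sqrt_pos.2 (hf.pos n)
  tendsto := (tendsto_atTop.2 fun b => (eventually_ge_atTop (b * b)).mono fun _ h =>
    Nat.le_sqrt.2 h).comp hf.tendsto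

/-- Countably many trees of width `√f` can be merged into one tree of width `f`, up to finite
modifications of the branches. -/
theorem exists_ofWidth_of_sqrt {f : ℕ → ℕ} (hf : IsCorset f) {S : ℕ → Set (List (Fin 2))}
    (hS : ∀ m, OfWidth (S m) fun n => (f n).sqrt) :
    ∃ T, IsTree T ∧ OfWidth T f ∧ ⋃ m, Lim (S m) ⊆ finClosure (Lim T) := by
  -- The `m`-th tree gets a stem of `k m` zeros. With `g = √(f n)`, only trees with `m < g - 1` can
  -- leave the zero branch by level `n`, so the level has at most `1 + (g - 1) * g ≤ g * g ≤ f n`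
  -- nodes.
  have : ∀ m : ℕ, ∃ k, ∀ n, k ≤ n → m + 2 ≤ (f n).sqrt := fun m =>
    eventually_atTop.1 (hf.sqrt.tendsto.eventually_ge_atTop (m + 2))
  choose k hk using this
  obtain ⟨T, hT, hPT, hw⟩ :=
    exists_isTree_subset_Lim (⋃ m, splice (initSeg 0 (k m)) '' Lim (S m))
  refine ⟨T, hT, fun n => hw n _ (hf.pos n) ?_, ?_⟩
  · set g := (f n).sqrt with hg
    have hgpos : 0 < g := hf.sqrt.pos n
    have hsub : (initSeg · n) '' (⋃ m, splice (initSeg 0 (k m)) '' Lim (S m)) ⊆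
        {initSeg 0 n} ∪ ⋃ m ∈ Finset.range (g - 1),
          (initSeg · n) '' (splice (initSeg 0 (k m)) '' Lim (S m)) := by
      rw [image_iUnion]
      refine iUnion_subset fun m => ?_
      rcases le_total n (k m) with hn | hn
      · rintro _ ⟨_, ⟨x, -, rfl⟩, rfl⟩
        refine Or.inl ?_
        have := initSeg_splice_of_le (s := initSeg 0 (k m)) x (n := n) (by rwa [length_initSeg])
        simpa only [take_initSeg _ hn, mem_singleton_iff] using this
      · have := hk m n hn
        refine subset_union_of_subset_right (subset_biUnion_of_mem (u := fun m =>
          (initSeg · n) '' (splice (initSeg 0 (k m)) '' Lim (S m))) ?_) _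
        simp only [Finset.mem_coe, Finset.mem_range]
        omega
    refine (encard_le_encard hsub).trans ((encard_union_le _ _).trans ?_)
    have h1 : (⋃ m ∈ Finset.range (g - 1),
          (initSeg · n) '' (splice (initSeg 0 (k m)) '' Lim (S m))).encard ≤
        ((g - 1) * g : ℕ) := by
      refine (Finset.set_encard_biUnion_le _ _).trans ?_
      refine (Finset.sum_le_card_nsmul _ _ (g : ℕ∞) fun m _ => ?_).trans ?_
      · exact (encard_image_initSeg_splice_le _ _ n).trans
          ((encard_le_encard (image_initSeg_Lim_subset _ n)).trans (hS m n))
      · simp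
    rw [encard_singleton]
    refine (add_le_add_right h1 1).trans ?_
    have h2 : 1 + (g - 1) * g ≤ f n := by
      refine le_trans ?_ (Nat.sqrt_le (f n))
      obtain ⟨c, hc⟩ : ∃ c, g = c + 1 := ⟨g - 1, by omega⟩
      rw [← hg, hc, Nat.add_sub_cancel]
      nlinarith
    exact_mod_cast h2
  · intro x hx
    obtain ⟨m, hm⟩ := mem_iUnion.1 hx
    refine ⟨splice (initSeg 0 (k m)) x, hPT (mem_iUnion.2 ⟨m, x, hm, rfl⟩),
      eventually_cofinite_eq_iff.2 ⟨k m, fun n hn => ?_⟩⟩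
    simp [splice, length_initSeg, not_lt.2 hn]

/-! ### Lebesgue measure, covers of null sets, and (d) → (a). -/

instance : IsProbabilityMeasure lebesgue := by
  unfold lebesgue
  infer_instance

theorem toMeasure_uniform_fin_two (a : Fin 2) :
    (PMF.uniformOfFintype (Fin 2)).toMeasure {a} = 2⁻¹ := by
  rw [PMF.toMeasure_apply_singleton _ _ (measurableSet_singleton a)]
  simp

instance : lebesgue.IsAddLeftInvariant where
  map_add_left_eq_self g := by
    unfold lebesgue
    have h := Measure.infinitePi_map_pi (fun _ : ℕ => (PMF.uniformOfFintype (Fin 2)).toMeasure)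
      (f := fun i a => g i + a) (fun i => measurable_of_countable _)
    refine h.trans ?_
    congr 1
    funext i
    refine Measure.ext_of_singleton fun a => ?_
    rw [Measure.map_apply (measurable_of_countable _) (measurableSet_singleton a)]
    have : (fun b => g i + b) ⁻¹' {a} = {-g i + a} := by
      ext b
      simp [eq_neg_add_iff_add_eq]
    rw [this, toMeasure_uniform_fin_two, toMeasure_uniform_fin_two]

theorem lebesgue_preimage_sub (x : Cantor) (A : Set Cantor) :
    lebesgue ((fun y => y - x) ⁻¹' A) = lebesgue A := by
  simp only [sub_eq_add_neg]
  exact measure_preimage_add_right _ _ _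

theorem lebesgue_cylinder_pos (x : Cantor) (n : ℕ) : 0 < lebesgue (PiNat.cylinder x n) := by
  have h : PiNat.cylinder x n = (Finset.range n : Set ℕ).pi fun i => {x i} := by
    ext y
    simp [PiNat.cylinder, Set.pi]
  rw [h, lebesgue, Measure.infinitePi_pi _ fun i _ => measurableSet_singleton _,
    Finset.prod_congr rfl fun i _ => toMeasure_uniform_fin_two (x i), Finset.prod_const]
  exact ENNReal.pow_pos (a := 2⁻¹) (by simp) _

theorem isOpen_of_determined {G : Set Cantor} {n : ℕ}
    (hG : ∀ x y : Cantor, (∀ i < n, x i = y i) → x ∈ G → y ∈ G) : IsOpen G := by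
  refine isOpen_iff_mem_nhds.2 fun x hx => mem_of_superset
    ((PiNat.isOpen_cylinder _ x n).mem_nhds (PiNat.self_mem_cylinder x n)) fun y hy => ?_
  exact hG x y (fun i hi => (hy i hi).symm) hx

/-- A null set is covered by the limit superior of a sequence of sets of summable measure, the
`n`-th of which depends only on the first `n` coordinates. -/
theorem exists_determined_cover {A : Set Cantor} (hA : lebesgue A = 0) :
    ∃ G : ℕ → Set Cantor, (∀ n, ∀ x y : Cantor, (∀ i < n, x i = y i) → x ∈ G n → y ∈ G n) ∧
      ∑' n, lebesgue (G n) ≠ ∞ ∧ A ⊆ limsup G atTop := by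
  have hU : ∀ k : ℕ, ∃ U ⊇ A, IsOpen U ∧ lebesgue U < 2⁻¹ ^ k := fun k =>
    A.exists_isOpen_lt_of_lt _ (by rw [hA]; exact ENNReal.pow_pos (by simp) k)
  choose U hAU hUo hUlt using hU
  have hcyl : ∀ {n : ℕ} {x y : Cantor}, (∀ i < n, x i = y i) →
      PiNat.cylinder x n = PiNat.cylinder y n := fun h =>
    PiNat.mem_cylinder_iff_eq.1 (PiNat.mem_cylinder_iff.2 h)
  -- `D k n` is the union of the maximal cylinders inside `U k` that have length `n`; for fixed `k`
  -- these sets are disjoint.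
  let D : ℕ → ℕ → Set Cantor := fun k n =>
    {y | PiNat.cylinder y n ⊆ U k ∧ ∀ m < n, ¬ PiNat.cylinder y m ⊆ U k}
  have hD : ∀ k n, ∀ x y : Cantor, (∀ i < n, x i = y i) → x ∈ D k n → y ∈ D k n := by
    rintro k n x y h ⟨h1, h2⟩
    refine ⟨by rwa [← hcyl h], fun m hm => ?_⟩
    rw [← hcyl fun i hi => h i (hi.trans hm)]
    exact h2 m hm
  have hDsum : ∀ k, ∑' n, lebesgue (D k n) ≤ 2⁻¹ ^ k := by
    intro k
    rw [← measure_iUnion _ fun n => (isOpen_of_determined (hD k n)).measurableSet]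
    · refine (measure_mono (iUnion_subset fun n y hy => ?_)).trans (hUlt k).le
      exact hy.1 (PiNat.self_mem_cylinder y n)
    · intro m n hmn
      refine disjoint_left.2 fun y hm hn => ?_
      rcases lt_or_gt_of_ne hmn with h | h
      · exact hn.2 m h hm.1
      · exact hm.2 n h hn.1
  refine ⟨fun n => ⋃ k, D k n, fun n x y h hx => ?_, ?_, fun x hx => ?_⟩
  · obtain ⟨k, hk⟩ := mem_iUnion.1 hx
    exact mem_iUnion.2 ⟨k, hD k n x y h hk⟩
  · refine ne_top_of_le_ne_top ?_ (ENNReal.tsum_le_tsum fun n => measure_iUnion_le fun k => D k n)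
    rw [ENNReal.tsum_comm]
    refine ne_top_of_le_ne_top ?_ (ENNReal.tsum_le_tsum hDsum)
    rw [ENNReal.tsum_geometric, ENNReal.one_sub_inv_two, inv_inv]
    exact ENNReal.ofNat_ne_top
  · rw [mem_limsup_iff_frequently_mem]
    intro hnot
    obtain ⟨N, hN⟩ := eventually_atTop.1 hnot
    -- If `x` lay in no `G n` with `n ≥ N`, one cylinder of positive measure would lie in every `U
    -- k`.
    have hsub : ∀ k, PiNat.cylinder x N ⊆ U k := by
      intro k
      have hex : ∃ n, PiNat.cylinder x n ⊆ U k := by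
        obtain ⟨v, ⟨z, n, rfl⟩, hxv, hv⟩ :=
          (PiNat.isTopologicalBasis_cylinders (fun _ : ℕ => Fin 2)).exists_subset_of_mem_open
            (hAU k hx) (hUo k)
        exact ⟨n, by rwa [PiNat.mem_cylinder_iff_eq.1 hxv]⟩
      classical
      have hmem : x ∈ D k (Nat.find hex) := ⟨Nat.find_spec hex, fun m hm => Nat.find_min hex hm⟩
      have hlt : Nat.find hex < N := by
        by_contra hge
        exact hN _ (not_lt.1 hge) (mem_iUnion.2 ⟨k, hmem⟩)
      exact (PiNat.cylinder_anti x hlt.le).trans (Nat.find_spec hex)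
    refine (lebesgue_cylinder_pos x N).not_ge (ge_of_tendsto'
      (ENNReal.tendsto_pow_atTop_nhds_zero_of_lt_one (r := 2⁻¹) (by simp)) fun k => ?_)
    exact (measure_mono (hsub k)).trans (hUlt k).le

/-- Let `f` go up by one at each `m k`, where the tail beyond `m k` is below `2⁻ᵏ`. Exchanging the
sums bounds the added cost by `∑ 2⁻ᵏ`. -/
theorem exists_isCorset_tsum_mul_ne_top {a : ℕ → ℝ≥0∞} (ha : ∑' n, a n ≠ ∞) :
    ∃ f, IsCorset f ∧ ∑' n, f n * a n ≠ ∞ := by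
  obtain ⟨m, hm, hma⟩ := extraction_forall_of_eventually
    (P := fun k n => ∑' i, a (i + n) < 2⁻¹ ^ k) fun k =>
      (ENNReal.tendsto_sum_nat_add a ha).eventually_lt_const (ENNReal.pow_pos (by simp) k)
  let f : ℕ → ℕ := fun n => 1 + ((Finset.range (n + 1)).filter fun k => m k ≤ n).card
  refine ⟨f, ⟨fun n n' h => ?_, fun n => by positivity, tendsto_atTop.2 fun b => ?_⟩, ?_⟩
  · refine Nat.add_le_add_left (Finset.card_le_card fun k hk => ?_) 1
    simp only [Finset.mem_filter, Finset.mem_range] at hk ⊢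
    omega
  · refine (eventually_ge_atTop (m b)).mono fun n hn => ?_
    have : Finset.range b ⊆ (Finset.range (n + 1)).filter fun k => m k ≤ n := by
      intro k hk
      have h1 := hm (Finset.mem_range.1 hk)
      have h2 := hm.id_le k
      simp only [Finset.mem_filter, Finset.mem_range, id] at h2 ⊢
      omega
    have := Finset.card_le_card this
    rw [Finset.card_range] at this
    exact this.trans (Nat.le_add_left _ _)
  · have hle : ∀ n, f n * a n ≤ a n + ∑' k, if m k ≤ n then a n else 0 := by
      intro n
      have : (f n : ℝ≥0∞) * a n = a n + ∑ k ∈ Finset.range (n + 1), if m k ≤ n then a n else 0 := by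
        rw [← Finset.sum_filter, Finset.sum_const, nsmul_eq_mul]
        simp only [f]
        push_cast
        ring
      rw [this]
      gcongr
      exact ENNReal.sum_le_tsum _
    refine ne_top_of_le_ne_top ?_ (ENNReal.tsum_le_tsum hle)
    rw [ENNReal.tsum_add, ENNReal.tsum_comm]
    refine ENNReal.add_ne_top.2 ⟨ha, ?_⟩
    have htail : ∀ k, (∑' n, if m k ≤ n then a n else 0) ≤ 2⁻¹ ^ k := by
      intro k
      rw [← ENNReal.summable.sum_add_tsum_nat_add' (k := m k), Finset.sum_eq_zero, zero_add]
      · simpa using (hma k).le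
      · intro i hi
        exact if_neg (not_le.2 (Finset.mem_range.1 hi))
    refine ne_top_of_le_ne_top ?_ (ENNReal.tsum_le_tsum htail)
    rw [ENNReal.tsum_geometric, ENNReal.one_sub_inv_two, inv_inv]
    exact ENNReal.ofNat_ne_top

theorem isNullAdditive_of_forall_isCorset {X : Set Cantor}
    (h : ∀ f : ℕ → ℕ, IsCorset f → ∃ S : ℕ → Set (List (Fin 2)),
      (∀ m, IsTree (S m) ∧ OfWidth (S m) f) ∧ X ⊆ ⋃ m, Lim (S m)) :
    IsNullAdditive X := by
  intro A hA
  obtain ⟨G, hG, hGsum, hAG⟩ := exists_determined_cover hA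
  obtain ⟨f, hf, hfsum⟩ := exists_isCorset_tsum_mul_ne_top hGsum
  obtain ⟨S, hS, hXS⟩ := h f hf
  let W : ℕ → ℕ → Set Cantor := fun m n =>
    ⋃ s ∈ level (S m) n, (fun y => y - splice s 0) ⁻¹' G n
  have hW : ∀ m n, lebesgue (W m n) ≤ f n * lebesgue (G n) := by
    intro m n
    have hfin : (level (S m) n).Finite := finite_of_encard_le_coe ((hS m).2 n)
    have hcard : hfin.toFinset.card ≤ f n := by
      have := (hS m).2 n
      rw [hfin.encard_eq_coe_toFinset_card] at this
      exact_mod_cast this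
    have : W m n = ⋃ s ∈ hfin.toFinset, (fun y => y - splice s 0) ⁻¹' G n := by simp [W]
    rw [this]
    refine (measure_biUnion_finset_le _ _).trans ?_
    simp only [lebesgue_preimage_sub, Finset.sum_const, nsmul_eq_mul]
    gcongr
  have hsub : X + A ⊆ ⋃ m, limsup (W m) atTop := by
    rintro _ ⟨x, hx, a, ha, rfl⟩
    obtain ⟨m, hm⟩ := mem_iUnion.1 (hXS hx)
    -- As `G n` sees only `n` coordinates, translating by `x` may be replaced by translating by its
    -- initial segment padded with zeros.
    refine mem_iUnion.2 ⟨m, mem_limsup_iff_frequently_mem.2 ?_⟩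
    refine (mem_limsup_iff_frequently_mem.1 (hAG ha)).mono fun n hn => ?_
    refine mem_biUnion (⟨hm n, length_initSeg x n⟩ : initSeg x n ∈ level (S m) n) ?_
    refine hG n a _ (fun i hi => ?_) hn
    simp [splice, initSeg, hi]
  refine measure_mono_null hsub (measure_iUnion_null fun m => measure_limsup_atTop_eq_zero ?_)
  exact ne_top_of_le_ne_top hfsum (ENNReal.tsum_le_tsum (hW m))

/-! ### Pairwise independent translates from affine hashing. -/

/-- The `i`-th bit of an affine hash of the first `N` coordinates of `y`, whose coefficients are
read off from the coordinates of `y` beyond `N`. -/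
def hash (N i : ℕ) (y : Cantor) : Fin 2 :=
  y (N + Nat.pair i N) + ∑ l ∈ Finset.range N, if y l = 1 then y (N + Nat.pair i l) else 0

theorem continuous_hash (N i : ℕ) : Continuous (hash N i) := by
  have h : ∀ l ∈ Finset.range N,
      Continuous fun y : Cantor => if y l = 1 then y (N + Nat.pair i l) else 0 := by
    intro l _
    have hp : Continuous fun y : Cantor => (y l, y (N + Nat.pair i l)) := by fun_prop
    exact (continuous_of_discreteTopology
      (f := fun p : Fin 2 × Fin 2 => if p.1 = 1 then p.2 else 0)).comp hp
  exact (continuous_apply (N + Nat.pair i N)).add (continuous_finsetSum _ h)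

/-- The points whose first `k` hash bits vanish. -/
def hashKernel (N k : ℕ) : Set Cantor :=
  {y | ∀ i < k, hash N i y = 0}

theorem isClopen_hashKernel (N k : ℕ) : IsClopen (hashKernel N k) := by
  have : hashKernel N k = ⋂ i ∈ Finset.range k, hash N i ⁻¹' {0} := by
    ext y
    simp [hashKernel]
  rw [this]
  exact isClopen_biInter_finset fun i _ => (isClopen_discrete _).preimage (continuous_hash N i)

/-- The element of `2^ω` whose addition changes the constant coefficient of the `i`-th hash bit by
`e i` and the coefficient of the coordinate `l` by `e' i`. -/
def coeffShift (N l : ℕ) (e e' : ℕ → Fin 2) : Cantor := fun j =>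
  if j < N then 0 else
    if (j - N).unpair.2 = N then e (j - N).unpair.1 else
      if (j - N).unpair.2 = l then e' (j - N).unpair.1 else 0

/-- The shift leaves the hashed coordinates below `N` alone, and the hash is additive in its
coefficients. -/
theorem hash_add_coeffShift {N l : ℕ} (hl : l < N) (e e' : ℕ → Fin 2) (i : ℕ) (y : Cantor) :
    hash N i (y + coeffShift N l e e') =
      hash N i y + (e i + if y l = 1 then e' i else 0) := by
  have h1 : (y + coeffShift N l e e') (N + Nat.pair i N) = y (N + Nat.pair i N) + e i := by
    simp [coeffShift]
  have h2 : ∀ j ∈ Finset.range N,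
      (if (y + coeffShift N l e e') j = 1 then
        (y + coeffShift N l e e') (N + Nat.pair i j) else 0) =
      (if y j = 1 then y (N + Nat.pair i j) else 0) +
        if j = l then (if y l = 1 then e' i else 0) else 0 := by
    intro j hj
    have hj := Finset.mem_range.1 hj
    have h3 : (y + coeffShift N l e e') j = y j := by simp [coeffShift, hj]
    have h4 : (y + coeffShift N l e e') (N + Nat.pair i j) =
        y (N + Nat.pair i j) + if j = l then e' i else 0 := by
      simp [coeffShift, hj.ne]
    rw [h3, h4]
    by_cases hjl : j = l
    · subst hjl
      by_cases hy : y j = 1 <;> simp [hy]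
    · simp [hjl]
  rw [hash, h1, Finset.sum_congr rfl h2, Finset.sum_add_distrib,
    Finset.sum_ite_eq' (Finset.range N) l, if_pos (Finset.mem_range.2 hl), hash]
  abel

/-- Extension of a finite sequence by zeros. -/
def extend {k : ℕ} (e : Fin k → Fin 2) : ℕ → Fin 2 :=
  fun i => if h : i < k then e ⟨i, h⟩ else 0

theorem extend_of_lt {k i : ℕ} (e : Fin k → Fin 2) (h : i < k) : extend e i = e ⟨i, h⟩ :=
  dif_pos h

theorem fin_two_add_eq_zero {a b : Fin 2} : a + b = 0 ↔ b = a := by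
  revert a b
  decide

/-- Replaces independence computations by counting disjoint translates. -/
theorem card_mul_lebesgue_eq {ι : Type*} [Fintype ι] {E : Set Cantor} (hE : MeasurableSet E)
    (t : ι → Cantor) (ht : Pairwise (Function.onFun Disjoint fun i => (fun y => y + t i) ⁻¹' E)) :
    Fintype.card ι * lebesgue E = lebesgue (⋃ i, (fun y => y + t i) ⁻¹' E) := by
  rw [measure_iUnion ht fun i => hE.preimage (measurable_add_const (t i)), tsum_fintype]
  simp

/-- For every `y`, exactly one of the `2 ^ k` changes of the constant coefficients makes all `k`
hash bits vanish. -/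
theorem lebesgue_hashKernel {N : ℕ} (hN : 0 < N) (k : ℕ) :
    lebesgue (hashKernel N k) = 2⁻¹ ^ k := by
  have key : ∀ (e : Fin k → Fin 2) (y : Cantor),
      y + coeffShift N 0 (extend e) 0 ∈ hashKernel N k ↔ ∀ i : Fin k, e i = hash N i y := by
    intro e y
    have : ∀ i (hi : i < k), hash N i (y + coeffShift N 0 (extend e) 0) = 0 ↔
        e ⟨i, hi⟩ = hash N i y := by
      intro i hi
      rw [hash_add_coeffShift hN, extend_of_lt e hi]
      simp [fin_two_add_eq_zero]
    exact ⟨fun h i => (this i i.2).1 (h i i.2), fun h i hi => (this i hi).2 (h ⟨i, hi⟩)⟩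
  have h := card_mul_lebesgue_eq (isClopen_hashKernel N k).2.measurableSet
    (fun e : Fin k → Fin 2 => coeffShift N 0 (extend e) 0) (by
      intro e e' hne
      refine disjoint_left.2 fun y hy hy' => hne (funext fun i => ?_)
      rw [(key e y).1 hy i, (key e' y).1 hy' i])
  have hU : ⋃ e : Fin k → Fin 2, (fun y => y + coeffShift N 0 (extend e) 0) ⁻¹' hashKernel N k =
      univ :=
    eq_univ_of_forall fun y =>
      mem_iUnion.2 ⟨fun i => hash N i y, (key _ y).2 fun i => rfl⟩
  rw [hU, measure_univ] at h
  rw [← ENNReal.inv_pow]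
  refine ENNReal.eq_inv_of_mul_eq_one_left ?_
  rw [mul_comm]
  simpa using h

/-- Translates of `hashKernel N k` by points that differ below `N` are pairwise independent. -/
theorem lebesgue_inter_hashKernel_le {N l : ℕ} (hl : l < N) (k : ℕ) {x x' : Cantor}
    (hx : x l ≠ x' l) :
    lebesgue ({y | y - x ∈ hashKernel N k} ∩ {y | y - x' ∈ hashKernel N k}) ≤ 2⁻¹ ^ k * 2⁻¹ ^ k := by
  set E := {y | y - x ∈ hashKernel N k} ∩ {y | y - x' ∈ hashKernel N k}
  have hmeas : MeasurableSet E :=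
    ((isClopen_hashKernel N k).2.measurableSet.preimage (measurable_sub_const x)).inter
      ((isClopen_hashKernel N k).2.measurableSet.preimage (measurable_sub_const x'))
  have h := card_mul_lebesgue_eq hmeas
    (fun e : (Fin k → Fin 2) × (Fin k → Fin 2) => coeffShift N l (extend e.1) (extend e.2)) (by
      intro e e' hne
      refine disjoint_left.2 fun y hy hy' => hne ?_
      have key : ∀ (z : Cantor) (i : Fin k),
          y + coeffShift N l (extend e.1) (extend e.2) - z ∈ hashKernel N k →
          y + coeffShift N l (extend e'.1) (extend e'.2) - z ∈ hashKernel N k →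
          (e.1 i + if (y - z) l = 1 then e.2 i else 0) =
            e'.1 i + if (y - z) l = 1 then e'.2 i else 0 := by
        intro z i h1 h2
        have h1 := h1 i i.2
        have h2 := h2 i i.2
        rw [add_sub_right_comm, hash_add_coeffShift hl, fin_two_add_eq_zero, extend_of_lt _ i.2,
          extend_of_lt _ i.2] at h1 h2
        exact h1.trans h2.symm
      -- Of `y - x` and `y - x'`, one has `l`-th bit `0` and determines `e.1`; the other has bit `1`
      -- and determines `e.1 + e.2`. So the `4 ^ k` translates are disjoint.
      have hd : ∀ a b c : Fin 2, b ≠ c →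
          (a - b = 1 ∧ a - c = 0) ∨ (a - b = 0 ∧ a - c = 1) := by decide
      have hfst : e.1 = e'.1 ∧ ∀ i, e.1 i + e.2 i = e'.1 i + e'.2 i := by
        rcases hd (y l) (x l) (x' l) hx with ⟨h1, h2⟩ | ⟨h1, h2⟩
        · exact ⟨funext fun i => by simpa [h2] using key x' i hy.2 hy'.2,
            fun i => by simpa [h1] using key x i hy.1 hy'.1⟩
        · exact ⟨funext fun i => by simpa [h1] using key x i hy.1 hy'.1,
            fun i => by simpa [h2] using key x' i hy.2 hy'.2⟩
      refine Prod.ext hfst.1 (funext fun i => ?_)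
      have := hfst.2 i
      rwa [hfst.1, add_right_inj] at this)
  have h1 : (2 ^ k * 2 ^ k : ℝ≥0∞) * lebesgue E ≤ 1 := by
    have : ((2 : ℝ≥0∞) ^ k * 2 ^ k) = (Fintype.card ((Fin k → Fin 2) × (Fin k → Fin 2)) : ℕ) := by
      simp
    rw [this, h]
    exact prob_le_one
  rw [← ENNReal.inv_pow, ← ENNReal.mul_inv (by simp) (by simp), ENNReal.le_inv_iff_mul_le, mul_comm]
  exact h1

/-! ### Chebyshev's inequality and the count of initial segments. -/

/-- A set that avoids many pairwise independent events of equal probability is small. -/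
theorem measureReal_mul_le_one_of_disjoint {Ω ι : Type*} [MeasurableSpace Ω] {μ : Measure Ω}
    [IsProbabilityMeasure μ] (s : Finset ι) {E : ι → Set Ω} (hE : ∀ i ∈ s, MeasurableSet (E i))
    {ε : ℝ} (hεE : ∀ i ∈ s, μ.real (E i) = ε)
    (hpair : ∀ i ∈ s, ∀ j ∈ s, i ≠ j → μ.real (E i ∩ E j) ≤ ε * ε)
    {B : Set Ω} (hB : MeasurableSet B) (hBE : ∀ i ∈ s, Disjoint B (E i)) :
    μ.real B * (s.card * ε) ≤ 1 := by
  classical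
  set b : ℝ := s.card * ε with hb
  by_cases hb0 : b ≤ 0
  · nlinarith [measureReal_nonneg (μ := μ) (s := B)]
  replace hb0 := not_le.1 hb0
  let F : ι → Ω → ℝ := fun i => (E i).indicator 1
  have hFF : ∀ i j, F i * F j = (E i ∩ E j).indicator 1 := fun i j =>
    (inter_indicator_one).symm
  have hint : ∀ i ∈ s, Integrable (F i) μ := fun i hi => (integrable_const 1).indicator (hE i hi)
  have hint2 : ∀ i ∈ s, ∀ j ∈ s, Integrable (F i * F j) μ := fun i hi j hj => by
    rw [hFF]
    exact (integrable_const 1).indicator ((hE i hi).inter (hE j hj))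
  have hsq : ∀ ω, (∑ i ∈ s, F i ω - b) ^ 2 =
      ∑ i ∈ s, ∑ j ∈ s, (F i * F j) ω - 2 * b * ∑ i ∈ s, F i ω + b ^ 2 := by
    intro ω
    simp only [Pi.mul_apply, ← Finset.sum_mul_sum]
    ring
  have i1 : Integrable (fun ω => ∑ i ∈ s, ∑ j ∈ s, (F i * F j) ω) μ :=
    integrable_finsetSum _ fun i hi => integrable_finsetSum _ fun j hj => hint2 i hi j hj
  have i2 : Integrable (fun ω => 2 * b * ∑ i ∈ s, F i ω) μ :=
    (integrable_finsetSum _ fun i hi => hint i hi).const_mul _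
  have hval : ∫ ω, (∑ i ∈ s, F i ω - b) ^ 2 ∂μ =
      ∑ i ∈ s, ∑ j ∈ s, μ.real (E i ∩ E j) - 2 * b * b + b ^ 2 := by
    simp only [hsq]
    rw [integral_add (by exact i1.sub i2) (integrable_const _), integral_sub i1 i2, integral_const_mul,
      integral_finsetSum _ fun i hi => hint i hi,
      integral_finsetSum _ fun i hi => integrable_finsetSum _ fun j hj => hint2 i hi j hj]
    have e1 : ∑ i ∈ s, ∫ ω, F i ω ∂μ = b := by
      rw [hb, ← nsmul_eq_mul]
      refine Finset.sum_eq_card_nsmul fun i hi => ?_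
      rw [← hεE i hi]
      exact integral_indicator_one (hE i hi)
    have e2 : ∑ i ∈ s, ∫ ω, ∑ j ∈ s, (F i * F j) ω ∂μ =
        ∑ i ∈ s, ∑ j ∈ s, μ.real (E i ∩ E j) := by
      refine Finset.sum_congr rfl fun i hi => ?_
      rw [integral_finsetSum _ fun j hj => hint2 i hi j hj]
      refine Finset.sum_congr rfl fun j hj => ?_
      rw [hFF]
      exact integral_indicator_one ((hE i hi).inter (hE j hj))
    rw [e1, e2]
    simp
  -- The diagonal contributes the extra `b`, so the variance is at most `b`; on `B` the squared
  -- deviation is `b ^ 2`.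
  have hle : ∑ i ∈ s, ∑ j ∈ s, μ.real (E i ∩ E j) ≤ b * b + b := by
    have : ∀ i ∈ s, ∑ j ∈ s, μ.real (E i ∩ E j) ≤ b * ε + ε := by
      intro i hi
      have h1 : ∀ j ∈ s, μ.real (E i ∩ E j) ≤ ε * ε + if j = i then ε else 0 := by
        intro j hj
        by_cases hji : j = i
        · subst hji
          rw [inter_self, hεE j hj, if_pos rfl]
          nlinarith
        · rw [if_neg hji, add_zero]
          exact hpair i hi j hj (Ne.symm hji)
      refine (Finset.sum_le_sum h1).trans (le_of_eq ?_)
      rw [Finset.sum_add_distrib, Finset.sum_ite_eq' s i, if_pos hi, Finset.sum_const,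
        nsmul_eq_mul, hb]
      ring
    refine (Finset.sum_le_card_nsmul _ _ _ this).trans (le_of_eq ?_)
    rw [nsmul_eq_mul, hb]
    ring
  have hlow : μ.real B * b ^ 2 ≤ ∫ ω, (∑ i ∈ s, F i ω - b) ^ 2 ∂μ := by
    have : ∫ ω, B.indicator (fun _ => b ^ 2) ω ∂μ = μ.real B * b ^ 2 := by
      rw [integral_indicator_const _ hB, smul_eq_mul]
    rw [← this]
    refine integral_mono ((integrable_const _).indicator hB) ?_ fun ω => ?_
    · simp only [hsq]
      exact (i1.sub i2).add (integrable_const _)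
    · by_cases hω : ω ∈ B
      · have : ∑ i ∈ s, F i ω = 0 := Finset.sum_eq_zero fun i hi =>
          indicator_of_notMem (disjoint_left.1 (hBE i hi) hω) _
        simp [hω, this]
      · simp only [indicator_of_notMem hω]
        positivity
  have : μ.real B * b * b ≤ 1 * b := by nlinarith
  exact le_of_mul_le_mul_right this hb0

/-- At most `4 ^ k` restrictions to `N` occur among the points `x` for which `x + hashKernel N k`
avoids a set of measure greater than `2 ^ (-k)`. -/
theorem encard_image_initSeg_le {N k : ℕ} (hN : 0 < N) {B : Set Cantor} (hB : MeasurableSet B)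
    (hBk : (2⁻¹ : ℝ) ^ k < lebesgue.real B) {P : Set Cantor}
    (hP : ∀ x ∈ P, ∀ y ∈ B, y - x ∉ hashKernel N k) :
    ((initSeg · N) '' P).encard ≤ (4 ^ k : ℕ) := by
  by_contra hlt
  obtain ⟨Q, hQP, hQ⟩ := exists_subset_bijOn P (initSeg · N)
  have hQle : ((4 ^ k : ℕ) : ℕ∞) ≤ Q.encard := by
    rw [← hQ.injOn.encard_image, hQ.image_eq]
    exact (not_le.1 hlt).le
  obtain ⟨t, htQ, htcard⟩ := exists_subset_encard_eq hQle
  have htfin : t.Finite := finite_of_encard_eq_coe htcard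
  have hscard : htfin.toFinset.card = 4 ^ k := by
    rw [htfin.encard_eq_coe_toFinset_card] at htcard
    exact_mod_cast htcard
  have hreal : ∀ x, lebesgue.real {y | y - x ∈ hashKernel N k} = (2⁻¹ : ℝ) ^ k := by
    intro x
    have : lebesgue {y | y - x ∈ hashKernel N k} = 2⁻¹ ^ k :=
      (lebesgue_preimage_sub x _).trans (lebesgue_hashKernel hN k)
    simp [Measure.real, this]
  have hcheb := measureReal_mul_le_one_of_disjoint (μ := lebesgue) htfin.toFinset
    (E := fun x => {y | y - x ∈ hashKernel N k}) (ε := 2⁻¹ ^ k)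
    (fun x _ => (isClopen_hashKernel N k).2.measurableSet.preimage (measurable_sub_const x))
    (fun x _ => hreal x) (fun x hx x' hx' hne => by
      have hdiff : ∃ l < N, x l ≠ x' l := by
        by_contra! hall
        exact hne (hQ.injOn (htQ (htfin.mem_toFinset.1 hx)) (htQ (htfin.mem_toFinset.1 hx'))
          (initSeg_eq_initSeg_iff.2 hall))
      obtain ⟨l, hl, hxl⟩ := hdiff
      have := ENNReal.toReal_mono (by finiteness) (lebesgue_inter_hashKernel_le hl k hxl)
      simpa [Measure.real] using this) hB
    (fun x hx => disjoint_left.2 fun y hy =>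
      hP x (hQP (htQ (htfin.mem_toFinset.1 hx))) y hy)
  rw [hscard] at hcheb
  -- With `4 ^ k` events the expected number that occur is `2 ^ k`, which forces `μ(B) ≤ 2⁻ᵏ`.
  have h4 : ((4 ^ k : ℕ) : ℝ) * 2⁻¹ ^ k = 2 ^ k := by
    push_cast
    rw [← mul_pow]
    norm_num
  rw [h4] at hcheb
  have h2 : (2⁻¹ : ℝ) ^ k * 2 ^ k = 1 := by
    rw [← mul_pow]
    norm_num
  have : (2⁻¹ : ℝ) ^ k * 2 ^ k < lebesgue.real B * 2 ^ k :=
    mul_lt_mul_of_pos_right hBk (by positivity)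
  linarith

theorem encard_image_initSeg_mono (P : Set Cantor) {m n : ℕ} (h : m ≤ n) :
    ((initSeg · m) '' P).encard ≤ ((initSeg · n) '' P).encard := by
  have : (initSeg · m) '' P = List.take m '' ((initSeg · n) '' P) := by
    rw [image_image]
    exact image_congr fun x _ => (take_initSeg x h).symm
  rw [this]
  exact encard_image_le _ _

/-! ### From null-additivity to trees: (a) → (c). -/

/-- The complement of a null set contains a closed set all of whose nonempty relatively open subsets
have positive measure. -/
theorem exists_isClosed_pos_of_null {Z : Set Cantor} (hZ : lebesgue Z = 0) :
    ∃ L : Set Cantor, IsClosed L ∧ L.Nonempty ∧ Disjoint L Z ∧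
      ∀ U, IsOpen U → (U ∩ L).Nonempty → 0 < lebesgue (U ∩ L) := by
  have hpos : 0 < lebesgue (toMeasurable lebesgue Z)ᶜ := by
    rw [prob_compl_eq_one_sub (measurableSet_toMeasurable _ _), measure_toMeasurable, hZ]
    simp
  obtain ⟨K, hKZ, hK, hKpos⟩ :=
    (measurableSet_toMeasurable lebesgue Z).compl.exists_lt_isCompact_of_ne_top
      (measure_ne_top _ _) hpos
  set ν := lebesgue.restrict K with hν
  have hν0 : ν ≠ 0 := by
    rw [hν, Ne, Measure.restrict_eq_zero]
    exact hKpos.ne'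
  have hLK : ν.support ⊆ K :=
    Measure.support_subset_of_isClosed hK.isClosed (self_mem_ae_restrict hK.measurableSet)
  refine ⟨ν.support, Measure.isClosed_support, Measure.nonempty_support hν0, ?_, ?_⟩
  · exact disjoint_left.2 fun y hy hyZ => hKZ (hLK hy) (subset_toMeasurable _ _ hyZ)
  · rintro U hU ⟨y, hyU, hyL⟩
    have h1 : 0 < ν U := (Measure.mem_support_iff_forall y).1 hyL U (hU.mem_nhds hyU)
    have h2 : ν (U ∩ ν.support) = ν U := measure_inter_conull Measure.measure_compl_support
    rw [← h2] at h1
    exact h1.trans_le (Measure.restrict_apply_le _ _)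

theorem exists_almostOfWidth_of_isNullAdditive {X : Set Cantor} (hX : IsNullAdditive X)
    {f : ℕ → ℕ} (hf : IsCorset f) :
    ∃ S : ℕ → Set (List (Fin 2)), (∀ m, IsTree (S m) ∧ AlmostOfWidth (S m) f) ∧
      X ⊆ ⋃ m, Lim (S m) := by
  obtain ⟨φ, hφ, hφf⟩ := extraction_forall_of_eventually
    (P := fun k n => 4 ^ k ≤ f n) fun k => hf.tendsto.eventually_ge_atTop (4 ^ k)
  have hN : ∀ k, 0 < φ (k + 1) := fun k => (Nat.zero_le _).trans_lt (hφ k.lt_succ_self)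
  -- Hashing up to `φ (k + 1)` gives the bound `4 ^ k ≤ f (φ k)` on all levels from `φ k` to `φ (k +
  -- 1)`.
  let C : ℕ → Set Cantor := fun k => hashKernel (φ (k + 1)) k
  have hC : ∀ k, IsClopen (C k) := fun k => isClopen_hashKernel _ _
  have hnull : lebesgue (limsup C atTop) = 0 := by
    refine measure_limsup_atTop_eq_zero ?_
    simp only [C, lebesgue_hashKernel (hN _)]
    rw [ENNReal.tsum_geometric, ENNReal.one_sub_inv_two, inv_inv]
    exact ENNReal.ofNat_ne_top
  obtain ⟨L, hL, hLne, hLX, hLpos⟩ := exists_isClosed_pos_of_null (hX _ hnull)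
  let P : ℕ → Set Cantor → Set Cantor := fun n U =>
    {x | ∀ k, n ≤ k → ∀ y ∈ U ∩ L, y - x ∉ C k}
  have hcover : ∀ x ∈ X, ∃ n, ∃ U ∈ TopologicalSpace.countableBasis Cantor,
      (U ∩ L).Nonempty ∧ x ∈ P n U := by
    intro x hx
    have : CompactSpace L := isCompact_iff_compactSpace.1 hL.isCompact
    have : Nonempty L := hLne.to_subtype
    -- Each `y ∈ L` has `y - x ∉ limsup C`, so these closed sets cover the compact space `L` and one
    -- has interior.
    obtain ⟨n, y, hy⟩ := nonempty_interior_of_iUnion_of_closed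
      (f := fun n : ℕ => {y : L | ∀ k, n ≤ k → (y : Cantor) - x ∉ C k}) (fun n => by
        simp only [ofPred_forall]
        refine isClosed_iInter fun k => isClosed_iInter fun _ => ?_
        exact (hC k).compl.1.preimage (continuous_subtype_val.sub continuous_const)) (by
        refine eq_univ_of_forall fun y => mem_iUnion.2 ?_
        have : (y : Cantor) - x ∉ limsup C atTop := fun h =>
          disjoint_left.1 hLX y.2 ⟨x, hx, _, h, add_sub_cancel _ _⟩
        rw [mem_limsup_iff_frequently_mem, not_frequently, eventually_atTop] at this
        exact this)
    obtain ⟨V, hV, hVL⟩ := isOpen_induced_iff.1 (isOpen_interior (s := {y : L |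
      ∀ k, n ≤ k → (y : Cantor) - x ∉ C k}))
    have hyV : (y : Cantor) ∈ V := by
      rw [← hVL] at hy
      exact hy
    obtain ⟨U, hU, hyU, hUV⟩ := (TopologicalSpace.isBasis_countableBasis
      Cantor).exists_subset_of_mem_open hyV hV
    refine ⟨n, U, hU, ⟨y, hyU, y.2⟩, fun k hk z hz => ?_⟩
    have : (⟨z, hz.2⟩ : L) ∈ Subtype.val ⁻¹' V := hUV hz.1
    rw [hVL] at this
    exact interior_subset this k hk
  have hwidth : ∀ n U, IsOpen U → (U ∩ L).Nonempty →
      ∀ᶠ m in atTop, ((initSeg · m) '' P n U).encard ≤ f m := by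
    intro n U hU hne
    have hpos : 0 < lebesgue.real (U ∩ L) :=
      ENNReal.toReal_pos (hLpos U hU hne).ne' (measure_ne_top _ _)
    obtain ⟨k₀, hk₀⟩ := eventually_atTop.1 ((tendsto_pow_atTop_nhds_zero_of_lt_one
      (r := (2⁻¹ : ℝ)) (by norm_num) (by norm_num)).eventually_lt_const hpos)
    refine (eventually_ge_atTop (φ (max n k₀))).mono fun m hm => ?_
    have hle : ∀ k, φ k ≤ m → k ≤ m := fun k hk => (hφ.id_le k).trans hk
    -- The search may stop at `m` because `k ≤ φ k`.
    set k := Nat.findGreatest (fun k => φ k ≤ m) m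
    have hmk : max n k₀ ≤ k := Nat.le_findGreatest (hle _ hm) hm
    have hφk : φ k ≤ m := Nat.findGreatest_spec (P := fun k => φ k ≤ m) (hle _ hm) hm
    have hφk' : m ≤ φ (k + 1) := by
      by_contra hlt
      exact Nat.not_succ_le_self k (Nat.le_findGreatest (P := fun k => φ k ≤ m)
        (hle _ (not_le.1 hlt).le) (not_le.1 hlt).le)
    refine (encard_image_initSeg_mono _ hφk').trans ((encard_image_initSeg_le (P := P n U) (hN k)
      (hU.measurableSet.inter hL.measurableSet) (hk₀ k ((le_max_right _ _).trans hmk))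
      fun x hx => hx k ((le_max_left _ _).trans hmk)).trans ?_)
    exact_mod_cast (hφf k).trans (hf.monotone hφk)
  have htree : ∀ p : ℕ × TopologicalSpace.countableBasis Cantor, ∃ T, IsTree T ∧
      AlmostOfWidth T f ∧ (((p.2 : Set Cantor) ∩ L).Nonempty → P p.1 p.2 ⊆ Lim T) := by
    rintro ⟨n, U, hU⟩
    by_cases hne : (U ∩ L).Nonempty
    · obtain ⟨T, hT, hPT, hw⟩ := exists_isTree_subset_Lim (P n U)
      refine ⟨T, hT, ?_, fun _ => hPT⟩
      exact (hwidth n U (TopologicalSpace.isOpen_of_mem_countableBasis hU) hne).mono fun m hm =>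
        hw m _ (hf.pos m) hm
    · obtain ⟨T, hT, -, hw⟩ := exists_isTree_subset_Lim ∅
      exact ⟨T, hT, Eventually.of_forall fun m => hw m _ (hf.pos m) (by simp),
        fun h => absurd h hne⟩
  choose T hT hw hLim using htree
  have : Nonempty (TopologicalSpace.countableBasis Cantor) := by
    obtain ⟨U, hU, -⟩ := (TopologicalSpace.isBasis_countableBasis
      Cantor).exists_subset_of_mem_open (mem_univ 0) isOpen_univ
    exact ⟨⟨U, hU⟩⟩
  obtain ⟨e, he⟩ := exists_surjective_nat (ℕ × TopologicalSpace.countableBasis Cantor)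
  refine ⟨fun m => T (e m), fun m => ⟨hT _, hw _⟩, fun x hx => ?_⟩
  obtain ⟨n, U, hU, hne, hxP⟩ := hcover x hx
  obtain ⟨i, hi⟩ := he (n, ⟨U, hU⟩)
  refine mem_iUnion.2 ⟨i, ?_⟩
  simp only [hi]
  exact hLim _ hne hxP

theorem subset_finClosure (A : Set Cantor) : A ⊆ finClosure A :=
  fun x hx => ⟨x, hx, Eventually.of_forall fun _ => rfl⟩

end NullAdditive

theorem theorem13 (X : Set NullAdditive.Cantor) :
    List.TFAE [
      NullAdditive.IsNullAdditive X,
      ∀ f : ℕ → ℕ, NullAdditive.IsCorset f →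
        ∃ S : Set (List (Fin 2)), NullAdditive.IsTree S ∧ NullAdditive.OfWidth S f ∧
          X ⊆ NullAdditive.finClosure (NullAdditive.Lim S),
      ∀ f : ℕ → ℕ, NullAdditive.IsCorset f →
        ∃ S : ℕ → Set (List (Fin 2)),
          (∀ m, NullAdditive.IsTree (S m) ∧ NullAdditive.AlmostOfWidth (S m) f) ∧
          X ⊆ ⋃ m, NullAdditive.finClosure (NullAdditive.Lim (S m)),
      ∀ f : ℕ → ℕ, NullAdditive.IsCorset f →
        ∃ S : ℕ → Set (List (Fin 2)),
          (∀ m, NullAdditive.IsTree (S m) ∧ NullAdditive.OfWidth (S m) f) ∧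
          X ⊆ ⋃ m, NullAdditive.Lim (S m)] := by
  tfae_have 1 → 3 := by
    intro h f hf
    obtain ⟨S, hS, hXS⟩ := NullAdditive.exists_almostOfWidth_of_isNullAdditive h hf
    exact ⟨S, hS, hXS.trans (Set.iUnion_mono fun m => NullAdditive.subset_finClosure _)⟩
  tfae_have 3 → 4 := by
    intro h f hf
    obtain ⟨S, hS, hXS⟩ := h f hf
    obtain ⟨T, hT, hST⟩ := NullAdditive.exists_ofWidth_of_almostOfWidth hf fun m => (hS m).2
    exact ⟨T, hT, hXS.trans hST⟩
  tfae_have 4 → 2 := by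
    intro h f hf
    obtain ⟨S, hS, hXS⟩ := h _ hf.sqrt
    obtain ⟨T, hT, hTf, hST⟩ := NullAdditive.exists_ofWidth_of_sqrt hf fun m => (hS m).2
    exact ⟨T, hT, hTf, hXS.trans hST⟩
  tfae_have 2 → 3 := by
    intro h f hf
    obtain ⟨S, hS, hSf, hXS⟩ := h f hf
    exact ⟨fun _ => S, fun _ => ⟨hS, Filter.Eventually.of_forall hSf⟩,
      hXS.trans (Set.subset_iUnion (fun _ : ℕ => NullAdditive.finClosure (NullAdditive.Lim S)) 0)⟩
  tfae_have 4 → 1 := NullAdditive.isNullAdditive_of_forall_isCorset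
  tfae_finish
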